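/- Let $(\overline M,\overline g)$ be a smooth Riemannian manifold with Levi-Civita connection $\overline\nabla$, let $p,q$ be positive integers, and let $J$ be a smooth $(1,1)$-tensor field on $\overline M$ with $J^2=pJ+qI$, $\overline g(JX,Y)=\overline g(X,JY)$ for all vector fields $X,Y$, and $\overline\nabla J=0$; that is, $(\overline M,\overline g,J)$ is a locally metallic Riemannian manifold (locally Golden if $p=q=1$). Let $i:M\to\overline M$ be an isometric immersion of a smooth Riemannian manifold $(M,g)$ with Levi-Civita connection $\nabla$, and identify tangent vectors of $M$ with their images under $i_*$. Suppose that $M$ is a semi-slant submanifold with distributions $D_1,D_2$: these are smooth distributions on $M$ such that $TM=D_1\oplus D_2$ is an orthogonal direct sum, $J(D_1)=D_1$, and there is a constant $\theta\neq0$ such that for every $x\in M$ and every nonzero $X\in (D_2)_x$ the angle between $JX$ and the subspace $(D_2)_x$ equals $\theta$. Let $T$ be the tangential part of $J$, i.e. $TX=(JX)^{\top}$, the orthogonal projection of $JX$ to $T_xM$, for $X\in T_xM$. If $\nabla T=0$, that is, $\nabla_X(TY)=T(\nabla_XY)$ for all vector fields $X,Y$ on open subsets of $M$, then both distributions $D_1$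 and $D_2$ are integrable: for $k=1,2$, the bracket $[X,Y]$ is a section of $D_k$ whenever $X,Y$ are smooth sections of $D_k$, and through every point of $M$ there passes an integral manifold of $D_k$. -/

import Mathlib

open Bundle Set VectorField
open scoped Manifold ContDiff Topology

noncomputable section

namespace MetallicGeometry

section Intrinsic

/-! ### Connections, distributions and integrability on one Riemannian manifold

`M` is a smooth manifold (without boundary) of dimension `d`.  A vector field over an open set `U`
is a function `X : Π x, T_x M` of which only the values on `U` matter. -/

variable {d : ℕ} {M : Type*} [TopologicalSpace M] [ChartedSpace (EuclideanSpace ℝ (Fin d)) M]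
  [IsManifold (𝓡 d) ∞ M]

/-- `X` is a smooth vector field on the set `U` (used for open `U`). -/
def IsSmoothVectorFieldOn (X : Π x : M, TangentSpace (𝓡 d) x) (U : Set M) : Prop :=
  ContMDiffOn (𝓡 d) ((𝓡 d).prod 𝓘(ℝ, EuclideanSpace ℝ (Fin d))) ∞
    (fun x => (⟨x, X x⟩ : TotalSpace (EuclideanSpace ℝ (Fin d))
      (TangentSpace (𝓡 d) : M → Type _))) U

/-- `D` is a smooth distribution, i.e. a smooth subbundle of the tangent bundle: every point has
an open neighbourhood on which `D` has a frame of smooth vector fields. -/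
def IsSmoothDistribution (D : Π x : M, Submodule ℝ (TangentSpace (𝓡 d) x)) : Prop :=
  ∀ x : M, ∃ (U : Set M) (k : ℕ) (X : Fin k → Π y : M, TangentSpace (𝓡 d) y),
    IsOpen U ∧ x ∈ U ∧ (∀ j, IsSmoothVectorFieldOn (X j) U) ∧
    ∀ y ∈ U, LinearIndependent ℝ (fun j => X j y) ∧
      Submodule.span ℝ (Set.range fun j => X j y) = D y

/-- `D` is involutive: `[X, Y]` is a section of `D` whenever `X`, `Y` are (local or global) smooth
sections of `D`. -/
def IsInvolutive (D : Π x : M, Submodule ℝ (TangentSpace (𝓡 d) x)) : Prop :=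
  ∀ (U : Set M) (X Y : Π x : M, TangentSpace (𝓡 d) x), IsOpen U →
    IsSmoothVectorFieldOn X U → IsSmoothVectorFieldOn Y U →
    (∀ x ∈ U, X x ∈ D x) → (∀ x ∈ U, Y x ∈ D x) →
    ∀ x ∈ U, mlieBracket (𝓡 d) X Y x ∈ D x

/-- Through every point of `M` there passes an integral manifold of `D`, given by an injective
immersion `φ` of an open set of some `ℝ^k` whose tangent spaces are the subspaces `D`. -/
def HasIntegralManifolds (D : Π x : M, Submodule ℝ (TangentSpace (𝓡 d) x)) : Prop :=
  ∀ x : M, ∃ (k : ℕ) (W : Set (EuclideanSpace ℝ (Fin k))) (φ : EuclideanSpace ℝ (Fin k) → M),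
    IsOpen W ∧ 0 ∈ W ∧ φ 0 = x ∧ ContMDiffOn (𝓡 k) (𝓡 d) ∞ φ W ∧ Set.InjOn φ W ∧
    ∀ u ∈ W, Function.Injective (mfderiv (𝓡 k) (𝓡 d) φ u) ∧
      LinearMap.range (mfderiv (𝓡 k) (𝓡 d) φ u).toLinearMap = D (φ u)

/-- `D` is integrable.  Both usual formulations are recorded: closure under the Lie bracket, and
the existence of an integral manifold through each point. -/
structure IsIntegrable (D : Π x : M, Submodule ℝ (TangentSpace (𝓡 d) x)) : Prop where
  involutive : IsInvolutive D
  integralManifolds : HasIntegralManifolds D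

/-- A field `A` of endomorphisms of the tangent spaces is parallel, `∇ A = 0`:
`(∇_v A) Y = ∇_v (A Y) - A (∇_v Y) = 0` for all local smooth vector fields `Y` and all tangent
vectors `v`.  Here `cov Y x v` is `∇_v Y` at `x`. -/
def IsParallel
    (cov : CovariantDerivative (𝓡 d) (EuclideanSpace ℝ (Fin d))
      (TangentSpace (𝓡 d) : M → Type _))
    (A : Π x : M, TangentSpace (𝓡 d) x →L[ℝ] TangentSpace (𝓡 d) x) : Prop :=
  ∀ (U : Set M) (Y : Π x : M, TangentSpace (𝓡 d) x), IsOpen U → IsSmoothVectorFieldOn Y U →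
    ∀ x ∈ U, ∀ v : TangentSpace (𝓡 d) x,
      cov (fun y => A y (Y y)) x v - A x (cov Y x v) = 0

variable [RiemannianBundle (fun x : M => TangentSpace (𝓡 d) x)]
  [IsContMDiffRiemannianBundle (𝓡 d) ∞ (EuclideanSpace ℝ (Fin d))
    (fun x : M => TangentSpace (𝓡 d) x)]

/-- A smooth metric is in particular of class `C¹` (found here without a long search). -/
instance instC1Metric : IsContMDiffRiemannianBundle (𝓡 d) 1 (EuclideanSpace ℝ (Fin d))
    (fun x : M => TangentSpace (𝓡 d) x) :=
  IsContMDiffRiemannianBundle.of_le (n := ∞) (by simp)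

/-- `cov` is the Levi-Civita connection: torsion-free and compatible with the metric. -/
structure IsLeviCivita
    (cov : CovariantDerivative (𝓡 d) (EuclideanSpace ℝ (Fin d))
      (TangentSpace (𝓡 d) : M → Type _)) : Prop where
  torsion_eq_zero : cov.torsion = 0
  metric : cov.IsMetricCompatible

/-- `J` is a `(p, q)`-metallic Riemannian structure: `p`, `q` are positive integers, `J` is a
smooth tensor field of type `(1, 1)` with `J² = p J + q I`, and the metric is `J`-compatible.
The Golden Riemannian structures are the case `p = q = 1`. -/
structure IsMetallicRiemannian (p q : ℕ)
    (J : Π x : M, TangentSpace (𝓡 d) x →L[ℝ] TangentSpace (𝓡 d) x) : Prop where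
  p_pos : 0 < p
  q_pos : 0 < q
  smooth : ContMDiff (𝓡 d)
    ((𝓡 d).prod 𝓘(ℝ, EuclideanSpace ℝ (Fin d) →L[ℝ] EuclideanSpace ℝ (Fin d))) ∞
    (fun x => TotalSpace.mk' (EuclideanSpace ℝ (Fin d) →L[ℝ] EuclideanSpace ℝ (Fin d))
      (E := fun x : M => TangentSpace (𝓡 d) x →L[ℝ] TangentSpace (𝓡 d) x) x (J x))
  sq : ∀ (x : M) (v : TangentSpace (𝓡 d) x), J x (J x v) = (p : ℝ) • J x v + (q : ℝ) • v
  compatible : ∀ (x : M) (v w : TangentSpace (𝓡 d) x), inner ℝ (J x v) w = inner ℝ v (J x w)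

/-- A locally metallic Riemannian manifold: `J` is a metallic Riemannian structure that is
parallel for the Levi-Civita connection `cov`. -/
structure IsLocallyMetallicRiemannian (p q : ℕ)
    (J : Π x : M, TangentSpace (𝓡 d) x →L[ℝ] TangentSpace (𝓡 d) x)
    (cov : CovariantDerivative (𝓡 d) (EuclideanSpace ℝ (Fin d))
      (TangentSpace (𝓡 d) : M → Type _)) : Prop where
  metallic : IsMetallicRiemannian p q J
  leviCivita : IsLeviCivita cov
  parallel : IsParallel cov J

end Intrinsic

section Submanifold

/-! ### Submanifolds of metallic Riemannian manifolds

`M` is isometrically immersed in `N` by `i`. -/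

instance instFiniteDimensionalTangentSpace {d : ℕ} {M : Type*} [TopologicalSpace M]
    [ChartedSpace (EuclideanSpace ℝ (Fin d)) M] (x : M) :
    FiniteDimensional ℝ (TangentSpace (𝓡 d) x) :=
  inferInstanceAs (FiniteDimensional ℝ (EuclideanSpace ℝ (Fin d)))

variable {n m : ℕ}
  {M : Type*} [TopologicalSpace M] [ChartedSpace (EuclideanSpace ℝ (Fin n)) M]
  [IsManifold (𝓡 n) ∞ M]
  [RiemannianBundle (fun x : M => TangentSpace (𝓡 n) x)]
  {N : Type*} [TopologicalSpace N] [ChartedSpace (EuclideanSpace ℝ (Fin m)) N]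
  [RiemannianBundle (fun x : N => TangentSpace (𝓡 m) x)]

variable (n m) in
/-- `i : M → N` is an isometric immersion: it is smooth and the metric of `M` is the one induced
by `i` (so the differential of `i` is injective at every point). -/
structure IsIsometricImmersion (i : M → N) : Prop where
  smooth : ContMDiff (𝓡 n) (𝓡 m) ∞ i
  isometric : ∀ (x : M) (u v : TangentSpace (𝓡 n) x),
    inner ℝ (mfderiv (𝓡 n) (𝓡 m) i x u) (mfderiv (𝓡 n) (𝓡 m) i x v) = inner ℝ u v

/-- The differential of an isometric immersion at `x`, as a linear isometry. -/
def IsIsometricImmersion.differential {i : M → N} (hi : IsIsometricImmersion n m i) (x : M) :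
    TangentSpace (𝓡 n) x →ₗᵢ[ℝ] TangentSpace (𝓡 m) (i x) :=
  (mfderiv (𝓡 n) (𝓡 m) i x).toLinearMap.isometryOfInner (hi.isometric x)

/-- The tangential part at `x` of a vector of the ambient space: its orthogonal projection to the
image of `T_x M`, read as an element of `T_x M`. -/
def IsIsometricImmersion.tangentialPart {i : M → N} (hi : IsIsometricImmersion n m i) (x : M) :
    TangentSpace (𝓡 m) (i x) →L[ℝ] TangentSpace (𝓡 n) x :=
  (hi.differential x).equivRange.symm.toContinuousLinearEquiv.toContinuousLinearMap ∘L
    (LinearMap.range (hi.differential x).toLinearMap).orthogonalProjectionOnto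

/-- The tangential part `T` of `J`, that is `T X = (J X)^T` for `X` tangent to `M`. -/
def IsIsometricImmersion.tangentialOperator {i : M → N} (hi : IsIsometricImmersion n m i)
    (J : Π y : N, TangentSpace (𝓡 m) y →L[ℝ] TangentSpace (𝓡 m) y) (x : M) :
    TangentSpace (𝓡 n) x →L[ℝ] TangentSpace (𝓡 n) x :=
  hi.tangentialPart x ∘L J (i x) ∘L (hi.differential x).toContinuousLinearMap

variable (m) in
/-- The image in `T_{i x} N` of the subspace `D x` of `T_x M`. -/
def pushDistribution (i : M → N) (D : Π x : M, Submodule ℝ (TangentSpace (𝓡 n) x)) (x : M) :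
    Submodule ℝ (TangentSpace (𝓡 m) (i x)) :=
  (D x).map (mfderiv (𝓡 n) (𝓡 m) i x).toLinearMap

/-- `D` is a slant distribution with slant angle `θ`: for every nonzero `v ∈ D x`, the angle
between `J v` and the subspace `D x`, i.e. the angle between `J v` and its orthogonal projection
to `D x`, is `θ`.  (The unoriented angle to the zero vector is `π / 2`, as it should be.) -/
def IsSlantDistribution (i : M → N)
    (J : Π y : N, TangentSpace (𝓡 m) y →L[ℝ] TangentSpace (𝓡 m) y)
    (D : Π x : M, Submodule ℝ (TangentSpace (𝓡 n) x)) (θ : ℝ) : Prop :=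
  ∀ (x : M), ∀ v ∈ D x, v ≠ 0 →
    InnerProductGeometry.angle (J (i x) (mfderiv (𝓡 n) (𝓡 m) i x v))
      ((pushDistribution m i D x).starProjection (J (i x) (mfderiv (𝓡 n) (𝓡 m) i x v))) = θ

/-- The immersed submanifold `i : M → N` is semi-slant with distributions `D₁`, `D₂`:
`TM = D₁ ⊕ D₂` orthogonally, `J D₁ = D₁`, and `D₂` is slant with an angle `θ ≠ 0`. -/
structure IsSemiSlant (i : M → N)
    (J : Π y : N, TangentSpace (𝓡 m) y →L[ℝ] TangentSpace (𝓡 m) y)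
    (D₁ D₂ : Π x : M, Submodule ℝ (TangentSpace (𝓡 n) x)) : Prop where
  smooth₁ : IsSmoothDistribution D₁
  smooth₂ : IsSmoothDistribution D₂
  orthogonal : ∀ x : M, ∀ u ∈ D₁ x, ∀ v ∈ D₂ x, inner ℝ u v = 0
  isCompl : ∀ x : M, IsCompl (D₁ x) (D₂ x)
  invariant : ∀ x : M,
    (pushDistribution m i D₁ x).map (J (i x)).toLinearMap = pushDistribution m i D₁ x
  slant : ∃ θ : ℝ, θ ≠ 0 ∧ IsSlantDistribution i J D₂ θ

end Submanifold

end MetallicGeometry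

end

/-!
The tangential operator `T` of a semi-slant submanifold determines both distributions by quadratic
equations with constant coefficients. On `D₁`, where `T` is the restriction of `J`, it satisfies
`T² = pT + q`. On `D₂` it is self-adjoint, maps `D₂` to itself, and `T v` corresponds to the
orthogonal projection of `J v` to `D₂`, so the slant condition says `|T v|² = l |J v|²` with
`l = cos² θ`; polarization turns this into `T² = l (pT + q)`. Since `θ ≠ 0` and the angle between a
vector and its projection is at most `π / 2`, `l ≠ 1` (unless `D₂ = 0`), and as `q ≠ 0` a vector
satisfying both equations vanishes. Hence each distribution is exactly the kernel of a polynomial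
in `T` (`IsSemiSlant.exists_mem_iff`).

If `∇ T = 0`, such a kernel is preserved by every `∇_X`, and because the connection is torsion-free
`[X, Y] = ∇_X Y - ∇_Y X` stays in it (`isInvolutive_of_isParallel`). To differentiate `T (T Y)` one
needs that `T` maps smooth fields to smooth fields. The products `⟨T Y, W⟩ = ⟨J Y, W⟩` with smooth
fields `W` are smooth, and the smoothness of `T Y` is recovered from them by inverting the Gram
matrix of a local frame (`contMDiffAt_of_inner`).

Integral manifolds come from the Frobenius theorem (`HasIntegralManifolds.of_isInvolutive`). In a
chart, a distribution is the range of an injective `X : E → (V →L E)`; with `P` a linear left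
inverse of `X z₀`, the field `F = X ∘ (P ∘ X)⁻¹` has the same range and satisfies `P ∘ F = id`, so
that involutivity becomes the symmetry of `(h, k) ↦ F'(z)(F(z) h) k`. This is the compatibility
condition for the system `φ' = F ∘ φ`, `φ 0 = z₀`. Its solution at `x` is the value at time `1` of
the curve with `y' = F(y) x`, `y 0 = z₀`. That `φ` has derivative `F (φ x)` at `x` follows from
Grönwall's inequality: by the symmetry condition `t ↦ y t + t F(y t) h` solves the equation for
`x + h` up to an error `O(|h|²)` (`exists_hasFDerivAt_of_lipschitz`). Smoothness of `φ` is then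
automatic from `φ' = F ∘ φ`.
-/

namespace MetallicGeometry

/-! ### The Frobenius theorem in a normed space -/

section Frobenius
variable {V E : Type*} [NormedAddCommGroup V] [NormedSpace ℝ V]
  [NormedAddCommGroup E] [NormedSpace ℝ E]

theorem gronwallBound_zero_eq_mul (K ε x : ℝ) :
    gronwallBound 0 K ε x = ε * gronwallBound 0 K 1 x := by
  unfold gronwallBound
  split_ifs <;> ring

theorem exists_hasDerivWithinAt_Icc_of_lipschitzWith [CompleteSpace E] {f : E → E} {C K : NNReal}
    (hC : ∀ z, ‖f z‖ ≤ C) (hK : LipschitzWith K f) (z₀ : E) :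
    ∃ y : ℝ → E, y 0 = z₀ ∧
      ∀ t ∈ Icc (0 : ℝ) 1, HasDerivWithinAt y (f (y t)) (Icc 0 1) t := by
  have hpl : IsPicardLindelof (fun _ : ℝ => f) (tmin := 0) (tmax := 1) ⟨0, by simp⟩ z₀ C 0 C K :=
    { lipschitzOnWith := fun _ _ => hK.lipschitzOnWith
      continuousOn := fun _ _ => continuousOn_const
      norm_le := fun _ _ z _ => hC z
      mul_max_le := by simp }
  simpa using hpl.exists_eq_forall_mem_Icc_hasDerivWithinAt₀

theorem norm_image_sub_sub_fderiv_le {F : E → V} {C : NNReal} (hF : Differentiable ℝ F)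
    (hC : LipschitzWith C (fderiv ℝ F)) (z w : E) :
    ‖F w - F z - fderiv ℝ F z (w - z)‖ ≤ C * ‖w - z‖ ^ 2 := by
  have h := (convex_segment z w).norm_image_sub_le_of_norm_fderiv_le' (𝕜 := ℝ) (f := F)
    (φ := fderiv ℝ F z) (C := C * ‖w - z‖) (fun x _ => hF x) (fun x hx => by
      refine (hC.norm_sub_le x z).trans ?_
      gcongr
      simpa using norm_sub_le_of_mem_segment hx)
    (left_mem_segment ℝ z w) (right_mem_segment ℝ z w)
  calc _ ≤ _ := h
    _ = _ := by ring

/-- Local solvability of `φ' = F ∘ φ`, `φ 0 = z₀` under the compatibility condition `hsymm`, for a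
globally bounded and Lipschitz `F` with Lipschitz derivative. -/
theorem exists_hasFDerivAt_of_lipschitz [CompleteSpace E]
    {F : E → V →L[ℝ] E} {C K C' : NNReal} {R : ℝ} {z₀ : E} (hR : 0 < R)
    (hF : Differentiable ℝ F) (hC : ∀ z, ‖F z‖ ≤ C) (hK : LipschitzWith K F)
    (hC' : LipschitzWith C' (fderiv ℝ F))
    (hsymm : ∀ z ∈ Metric.ball z₀ R, ∀ h k, fderiv ℝ F z (F z h) k = fderiv ℝ F z (F z k) h) :
    ∃ r > 0, ∃ φ : V → E, φ 0 = z₀ ∧ ∀ u ∈ Metric.ball (0 : V) r,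
      φ u ∈ Metric.ball z₀ R ∧ HasFDerivAt φ (F (φ u)) u := by
  have hlip : ∀ x : V, LipschitzWith (K * ‖x‖₊) (fun z => F z x) := fun x =>
    LipschitzWith.of_dist_le_mul fun z w => by
      rw [dist_eq_norm, dist_eq_norm, ← sub_apply]
      calc ‖(F z - F w) x‖ ≤ ‖F z - F w‖ * ‖x‖ := (F z - F w).le_opNorm x
        _ ≤ K * ‖z - w‖ * ‖x‖ := by gcongr; exact hK.norm_sub_le z w
        _ = _ := by push_cast; ring
  have hbd : ∀ (x : V) z, ‖F z x‖ ≤ (C * ‖x‖₊ : NNReal) := fun x z => by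
    push_cast
    exact ((F z).le_opNorm x).trans (by gcongr; exact hC z)
  choose y hy0 hy using fun x : V =>
    exists_hasDerivWithinAt_Icc_of_lipschitzWith (hbd x) (hlip x) z₀
  have hnear : ∀ x, ∀ t ∈ Icc (0 : ℝ) 1, ‖y x t - z₀‖ ≤ C * ‖x‖ := fun x t ht => by
    have := (convex_Icc (0 : ℝ) 1).norm_image_sub_le_of_norm_hasDerivWithin_le (hy x)
      (fun s _ => hbd x (y x s)) (left_mem_Icc.2 zero_le_one) ht
    rw [hy0] at this
    refine this.trans ?_
    push_cast
    have h1 : ‖t - 0‖ ≤ 1 := by simpa [abs_of_nonneg ht.1] using ht.2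
    exact mul_le_of_le_one_right (by positivity) h1
  have hright : ∀ x, ∀ t ∈ Ico (0 : ℝ) 1, HasDerivWithinAt (y x) (F (y x t) x) (Ici t) t :=
    fun x t ht => (hy x t (Ico_subset_Icc_self ht)).mono_of_mem_nhdsWithin
      (Icc_mem_nhdsGE_of_mem ht)
  have hcont : ∀ x, ContinuousOn (y x) (Icc 0 1) := fun x t ht => (hy x t ht).continuousWithinAt
  have hball : ∀ x ∈ Metric.ball (0 : V) (R / (C + 1)), ∀ t ∈ Icc (0 : ℝ) 1,
      y x t ∈ Metric.ball z₀ R := fun x hx t ht => by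
    rw [mem_ball_iff_norm]
    rw [mem_ball_zero_iff, lt_div_iff₀ (by positivity)] at hx
    refine (hnear x t ht).trans_lt ?_
    nlinarith [norm_nonneg x]
  refine ⟨R / (C + 1), by positivity, fun x => y x 1, ?_, fun x hx => ⟨hball x hx 1 (by simp), ?_⟩⟩
  · simpa [sub_eq_zero] using hnear 0 1 (by simp)
  set M₀ : ℝ := C' * C ^ 2 * (‖x‖ + 1) + K * C with hM₀
  set K₁ : NNReal := K * (‖x‖₊ + 1) with hK₁
  have key : ∀ h : V, ‖h‖ ≤ 1 →
      ‖y (x + h) 1 - y x 1 - F (y x 1) h‖ ≤ M₀ * gronwallBound 0 K₁ 1 1 * ‖h‖ ^ 2 := by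
    intro h hh
    have hxh : ‖x + h‖ ≤ ‖x‖ + 1 := (norm_add_le x h).trans (by gcongr)
    -- `t ↦ y x t + t • F (y x t) h` solves the equation with parameter `x + h` up to `O(‖h‖²)`
    have happrox : ∀ t ∈ Ico (0 : ℝ) 1,
        HasDerivWithinAt (fun t => y x t + t • F (y x t) h)
          (F (y x t) x + (t • fderiv ℝ F (y x t) (F (y x t) x) h + (1 : ℝ) • F (y x t) h))
          (Ici t) t := fun t ht => by
      have h1 := hright x t ht
      have h2 := ((hF (y x t)).hasFDerivAt.comp_hasDerivWithinAt t h1).clm_apply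
        (hasDerivWithinAt_const t (Ici t) h)
      simp only [map_zero, add_zero] at h2
      exact h1.add ((hasDerivWithinAt_id t (Ici t)).smul h2)
    have herr : ∀ t ∈ Ico (0 : ℝ) 1,
        dist (F (y x t) x + (t • fderiv ℝ F (y x t) (F (y x t) x) h + (1 : ℝ) • F (y x t) h))
          (F (y x t + t • F (y x t) h) (x + h)) ≤ M₀ * ‖h‖ ^ 2 := fun t ht => by
      set z := y x t with hz
      have hs := hsymm z (hball x hx t (Ico_subset_Icc_self ht)) h x
      have ht1 : ‖t‖ ≤ 1 := by rw [Real.norm_of_nonneg ht.1]; exact ht.2.le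
      have hFh : ‖F z h‖ ≤ C * ‖h‖ := hbd h z
      have htF : ‖t • F z h‖ ≤ C * ‖h‖ := by
        rw [norm_smul]
        exact (mul_le_of_le_one_left (norm_nonneg _) ht1).trans hFh
      have e : F z x + (t • fderiv ℝ F z (F z x) h + (1 : ℝ) • F z h)
          - F (z + t • F z h) (x + h) =
          -((F (z + t • F z h) - F z - fderiv ℝ F z ((z + t • F z h) - z)) (x + h))
            - t • fderiv ℝ F z (F z h) h := by
        simp only [add_sub_cancel_left, map_smul, sub_apply, smul_apply,
          map_add, ← hs, one_smul]
        abel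
      have h1 : ‖(F (z + t • F z h) - F z - fderiv ℝ F z ((z + t • F z h) - z)) (x + h)‖ ≤
          C' * (C * ‖h‖) ^ 2 * (‖x‖ + 1) := by
        refine (ContinuousLinearMap.le_opNorm _ _).trans ?_
        have := norm_image_sub_sub_fderiv_le hF hC' z (z + t • F z h)
        rw [add_sub_cancel_left] at this ⊢
        gcongr
        exact this.trans (by gcongr)
      have h2 : ‖t • fderiv ℝ F z (F z h) h‖ ≤ K * (C * ‖h‖) * ‖h‖ := by
        rw [norm_smul]
        refine (mul_le_of_le_one_left (norm_nonneg _) ht1).trans ?_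
        refine (ContinuousLinearMap.le_opNorm _ _).trans ?_
        gcongr
        refine (ContinuousLinearMap.le_opNorm _ _).trans ?_
        gcongr
        exact norm_fderiv_le_of_lipschitz ℝ hK
      rw [dist_eq_norm, e]
      calc _ ≤ _ := norm_sub_le _ _
        _ ≤ C' * (C * ‖h‖) ^ 2 * (‖x‖ + 1) + K * (C * ‖h‖) * ‖h‖ := by
          rw [norm_neg]; exact add_le_add h1 h2
        _ = _ := by rw [hM₀]; ring
    have hg := dist_le_of_approx_trajectories_ODE (v := fun _ z => F z (x + h)) (K := K₁)
      (a := 0) (b := 1) (δ := 0) (εf := 0) (εg := M₀ * ‖h‖ ^ 2)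
      (f := y (x + h)) (f' := fun t => F (y (x + h) t) (x + h))
      (fun _ => (hlip (x + h)).weaken (by
        rw [hK₁]; gcongr; exact_mod_cast hxh)) (hcont _) (hright _) (by simp)
      ((hcont x).add (continuousOn_id.smul
        ((hF.continuous.comp_continuousOn (hcont x)).clm_apply continuousOn_const)))
      happrox herr (by simp [hy0]) 1 (by simp)
    rw [dist_eq_norm, zero_add, sub_zero, gronwallBound_zero_eq_mul] at hg
    rw [sub_sub]
    calc _ = _ := by simp
      _ ≤ _ := hg
      _ = _ := by ring
  rw [hasFDerivAt_iff_isLittleO_nhds_zero]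
  refine Asymptotics.IsBigO.trans_isLittleO (g := fun h : V => ‖h‖ ^ 2)
    (Asymptotics.IsBigO.of_bound (M₀ * gronwallBound 0 K₁ 1 1) ?_) ?_
  · filter_upwards [Metric.closedBall_mem_nhds (0 : V) one_pos] with h hh
    simpa using key h (by simpa using hh)
  · simpa using Asymptotics.isLittleO_norm_pow_id (E' := V) one_lt_two

theorem exists_lipschitzWith_fderiv_of_hasCompactSupport {G : E → V} (hG : ContDiff ℝ ∞ G)
    (hGc : HasCompactSupport G) : ∃ K, LipschitzWith K (fderiv ℝ G) :=
  ContDiff.lipschitzWith_of_hasCompactSupport (hGc.fderiv ℝ)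
    (hG.fderiv_right (m := ∞) (by simp)) (by simp)

/-- Local solvability of `φ' = F ∘ φ`, `φ 0 = z₀` by a smooth `φ`, for smooth `F` satisfying the
compatibility condition `hsymm`. -/
theorem exists_contDiffOn_hasFDerivAt [FiniteDimensional ℝ E] {F : E → V →L[ℝ] E} {Ω : Set E}
    (hΩ : IsOpen Ω) {z₀ : E} (hz₀ : z₀ ∈ Ω) (hF : ContDiffOn ℝ ∞ F Ω)
    (hsymm : ∀ z ∈ Ω, ∀ h k, fderiv ℝ F z (F z h) k = fderiv ℝ F z (F z k) h) :
    ∃ r > 0, ∃ φ : V → E, φ 0 = z₀ ∧ ContDiffOn ℝ ∞ φ (Metric.ball 0 r) ∧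
      ∀ u ∈ Metric.ball (0 : V) r, φ u ∈ Ω ∧ HasFDerivAt φ (F (φ u)) u := by
  have : CompleteSpace E := FiniteDimensional.complete ℝ E
  obtain ⟨ε, hε, hεΩ⟩ := Metric.isOpen_iff.1 hΩ z₀ hz₀
  -- extend `F` from a ball around `z₀` to a compactly supported function on the whole space
  let χ : ContDiffBump z₀ := ⟨ε / 3, ε / 2, by positivity, by linarith⟩
  set G : E → V →L[ℝ] E := fun z => χ z • F z with hG
  have hsub : tsupport χ ⊆ Ω := by
    rw [χ.tsupport_eq]
    exact (Metric.closedBall_subset_ball (by change ε / 2 < ε; linarith)).trans hεΩ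
  have hGs : ContDiff ℝ ∞ G := by
    rw [contDiff_iff_contDiffAt]
    intro z
    by_cases hz : z ∈ Ω
    · exact χ.contDiffAt.smul (hF.contDiffAt (hΩ.mem_nhds hz))
    · have hz' : z ∉ tsupport χ := fun h => hz (hsub h)
      refine (contDiffAt_const (c := (0 : V →L[ℝ] E))).congr_of_eventuallyEq ?_
      filter_upwards [(isClosed_tsupport χ).isOpen_compl.mem_nhds hz'] with w hw
      simp [hG, image_eq_zero_of_notMem_tsupport hw]
  have hGc : HasCompactSupport G := χ.hasCompactSupport.smul_right
  have hGF : ∀ z ∈ Metric.ball z₀ (ε / 3), G =ᶠ[𝓝 z] F := fun z hz => by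
    filter_upwards [Metric.isOpen_ball.mem_nhds hz] with w hw
    simp [hG, χ.one_of_mem_closedBall (Metric.ball_subset_closedBall hw)]
  have hsub' : Metric.ball z₀ (ε / 3) ⊆ Ω :=
    (Metric.ball_subset_ball (by linarith)).trans hεΩ
  obtain ⟨C, hC⟩ := hGc.exists_bound_of_continuous hGs.continuous
  obtain ⟨K, hK⟩ := hGs.lipschitzWith_of_hasCompactSupport hGc (by simp)
  obtain ⟨C', hC'⟩ := exists_lipschitzWith_fderiv_of_hasCompactSupport hGs hGc
  obtain ⟨r, hr, φ, hφ0, hφ⟩ := exists_hasFDerivAt_of_lipschitz (F := G) (C := C.toNNReal)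
    (R := ε / 3) (z₀ := z₀) (by positivity) (hGs.differentiable (by simp))
    (fun z => (hC z).trans (Real.le_coe_toNNReal C)) hK hC' (fun z hz h k => by
      rw [(hGF z hz).fderiv_eq, (hGF z hz).eq_of_nhds]
      exact hsymm z (hsub' hz) h k)
  have hφ' : ∀ u ∈ Metric.ball (0 : V) r, φ u ∈ Ω ∧ HasFDerivAt φ (F (φ u)) u := fun u hu => by
    obtain ⟨h1, h2⟩ := hφ u hu
    rw [(hGF _ h1).eq_of_nhds] at h2
    exact ⟨hsub' h1, h2⟩
  refine ⟨r, hr, φ, hφ0, ?_, hφ'⟩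
  -- bootstrapping: `fderiv φ = F ∘ φ` is as smooth as `φ`
  have hdiff : DifferentiableOn ℝ φ (Metric.ball 0 r) :=
    fun u hu => (hφ' u hu).2.differentiableAt.differentiableWithinAt
  rw [contDiffOn_infty]
  intro n
  induction n with
  | zero => simpa using hdiff.continuousOn
  | succ n ih =>
    push_cast
    rw [contDiffOn_succ_iff_fderiv_of_isOpen Metric.isOpen_ball]
    refine ⟨hdiff, by simp, ?_⟩
    exact ((hF.of_le (by exact_mod_cast le_top)).comp ih fun u hu => (hφ' u hu).1).congr
      fun u hu => (hφ' u hu).2.fderiv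

/-- The **Frobenius theorem** in a finite-dimensional space, for the distribution spanned by a frame
`X`. The vector fields `z ↦ X z a` with constant `a` span the distribution, and `hinv` says that
their brackets are sections of it. -/
theorem exists_hasFDerivAt_comp_of_involutive [FiniteDimensional ℝ E] [FiniteDimensional ℝ V]
    {X : E → V →L[ℝ] E} {Ω : Set E} (hΩ : IsOpen Ω) {z₀ : E} (hz₀ : z₀ ∈ Ω)
    (hX : ContDiffOn ℝ ∞ X Ω) (hinj : Function.Injective (X z₀))
    (hinv : ∀ z ∈ Ω, ∀ a b, ∃ c, fderiv ℝ X z (X z a) b - fderiv ℝ X z (X z b) a = X z c) :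
    ∃ r > 0, ∃ φ : V → E, φ 0 = z₀ ∧ ContDiffOn ℝ ∞ φ (Metric.ball 0 r) ∧
      InjOn φ (Metric.ball 0 r) ∧ ∀ u ∈ Metric.ball (0 : V) r, φ u ∈ Ω ∧
        ∃ L : V ≃L[ℝ] V, HasFDerivAt φ (X (φ u) ∘L (L : V →L[ℝ] V)) u := by
  have : CompleteSpace V := FiniteDimensional.complete ℝ V
  obtain ⟨P, hP⟩ := ContinuousLinearMap.HasLeftInverse.of_injective_of_finiteDimensional hinj
  set A : E → V →L[ℝ] V := fun z => P ∘L X z with hA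
  have hAs : ContDiffOn ℝ ∞ A Ω := contDiffOn_const.clm_comp hX
  set Ω' : Set E := Ω ∩ A ⁻¹' {T | IsUnit T} with hΩ'
  have hΩ'o : IsOpen Ω' := hAs.continuousOn.isOpen_inter_preimage hΩ Units.isOpen
  have hz₀' : z₀ ∈ Ω' := ⟨hz₀, by
    have : A z₀ = 1 := by ext v; exact hP v
    simp [this]⟩
  set B : E → V →L[ℝ] V := fun z => Ring.inverse (A z) with hB
  have hBs : ContDiffOn ℝ ∞ B Ω' := fun z hz => by
    obtain ⟨u, hu⟩ := hz.2
    have : ContDiffAt ℝ ∞ Ring.inverse (A z) := hu ▸ contDiffAt_ringInverse ℝ u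
    exact this.comp_contDiffWithinAt z ((hAs z hz.1).mono inter_subset_left)
  have hAB : ∀ z ∈ Ω', A z * B z = 1 := fun z hz => Ring.mul_inverse_cancel _ hz.2
  have hBA : ∀ z ∈ Ω', B z * A z = 1 := fun z hz => Ring.inverse_mul_cancel _ hz.2
  set F : E → V →L[ℝ] E := fun z => X z ∘L B z with hF
  have hFs : ContDiffOn ℝ ∞ F Ω' := (hX.mono inter_subset_left).clm_comp hBs
  have hPF : ∀ z ∈ Ω', ∀ v, P (F z v) = v := fun z hz v => congr($(hAB z hz) v)
  have hsymm : ∀ z ∈ Ω', ∀ h k, fderiv ℝ F z (F z h) k = fderiv ℝ F z (F z k) h := by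
    intro z hz h k
    have hXd : DifferentiableAt ℝ X z :=
      (hX.contDiffAt (hΩ.mem_nhds hz.1)).differentiableAt (by simp)
    have hBd : DifferentiableAt ℝ B z :=
      (hBs.contDiffAt (hΩ'o.mem_nhds hz)).differentiableAt (by simp)
    have hFd : DifferentiableAt ℝ F z := hXd.clm_comp hBd
    have hd : ∀ v w, fderiv ℝ F z v w = X z (fderiv ℝ B z v w) + fderiv ℝ X z v (B z w) := by
      intro v w
      rw [hF, fderiv_clm_comp hXd hBd]
      simp
    have hPd : ∀ v w, P (fderiv ℝ F z v w) = 0 := by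
      intro v w
      have h1 : HasFDerivAt (fun z => P (F z w)) (P ∘L ((fderiv ℝ F z).flip w)) z :=
        P.hasFDerivAt.comp z (hFd.hasFDerivAt.clm_apply (hasFDerivAt_const w z) |>.congr_fderiv
          (by ext; simp))
      have h2 : HasFDerivAt (fun z => P (F z w)) (0 : E →L[ℝ] V) z :=
        (hasFDerivAt_const w z).congr_of_eventuallyEq (by
          filter_upwards [hΩ'o.mem_nhds hz] with y hy using hPF y hy w)
      exact congr($(h1.unique h2) v)
    obtain ⟨c, hc⟩ := hinv z hz.1 (B z h) (B z k)
    -- the difference is in the range of `X z`, on which `P` is injective, and `P` kills it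
    have hdiff : fderiv ℝ F z (F z h) k - fderiv ℝ F z (F z k) h =
        X z (fderiv ℝ B z (F z h) k - fderiv ℝ B z (F z k) h + c) := by
      rw [hd, hd, map_add, ← hc, map_sub]
      simp only [hF, ContinuousLinearMap.comp_apply]
      abel
    have h0 : A z (fderiv ℝ B z (F z h) k - fderiv ℝ B z (F z k) h + c) = 0 := by
      change P (X z _) = 0
      rw [← hdiff, map_sub, hPd, hPd, sub_zero]
    have h1 := congr($(hBA z hz) (fderiv ℝ B z (F z h) k - fderiv ℝ B z (F z k) h + c))
    rw [mul_apply_eq_comp, h0, map_zero, one_apply_eq_self] at h1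
    rw [← sub_eq_zero, hdiff, ← h1, map_zero]
  obtain ⟨r, hr, φ, hφ0, hφs, hφ⟩ := exists_contDiffOn_hasFDerivAt hΩ'o hz₀' hFs hsymm
  refine ⟨r, hr, φ, hφ0, hφs, ?_, fun u hu => ⟨(hφ u hu).1.1, ?_⟩⟩
  · -- `P ∘ φ` has derivative the identity, so it is a translation
    have hder : ∀ u ∈ Metric.ball (0 : V) r,
        HasFDerivWithinAt (fun u => P (φ u) - u) (0 : V →L[ℝ] V) (Metric.ball 0 r) u := by
      intro u hu
      have := (P.hasFDerivAt.comp u (hφ u hu).2).sub (hasFDerivAt_id u)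
      refine (this.congr_fderiv ?_).hasFDerivWithinAt
      ext v
      simp [hPF _ (hφ u hu).1]
    intro u hu v hv huv
    have := (convex_ball (0 : V) r).is_const_of_fderivWithin_eq_zero
      (fun u hu => (hder u hu).differentiableWithinAt)
      (fun u hu => (hder u hu).fderivWithin (Metric.isOpen_ball.uniqueDiffWithinAt hu)) hu hv
    simpa [huv] using this
  · exact ⟨ContinuousLinearEquiv.equivOfInverse (B (φ u)) (A (φ u))
      (fun v => congr($(hAB _ (hφ u hu).1) v)) (fun v => congr($(hBA _ (hφ u hu).1) v)),
      (hφ u hu).2⟩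

end Frobenius

/-! ### The Frobenius theorem on a manifold -/

section Integral
variable {d : ℕ} {M : Type*} [TopologicalSpace M] [ChartedSpace (EuclideanSpace ℝ (Fin d)) M]
  [IsManifold (𝓡 d) ∞ M]

theorem IsSmoothVectorFieldOn.contMDiffAt {X : Π x : M, TangentSpace (𝓡 d) x} {U : Set M}
    (hX : IsSmoothVectorFieldOn X U) (hU : IsOpen U) {x : M} (hx : x ∈ U) :
    ContMDiffAt (𝓡 d) ((𝓡 d).prod 𝓘(ℝ, EuclideanSpace ℝ (Fin d))) ∞ (T% X) x :=
  ContMDiffOn.contMDiffAt hX (hU.mem_nhds hx)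

theorem contMDiffAt_extChartAt_symm {x : M} {z : EuclideanSpace ℝ (Fin d)}
    (hz : z ∈ (extChartAt (𝓡 d) x).target) :
    ContMDiffAt (𝓡 d) (𝓡 d) ∞ (extChartAt (𝓡 d) x).symm z :=
  (contMDiffOn_extChartAt_symm x).contMDiffAt ((isOpen_extChartAt_target x).mem_nhds hz)

theorem isInvertible_mfderiv_extChartAt_symm {x : M} {z : EuclideanSpace ℝ (Fin d)}
    (hz : z ∈ (extChartAt (𝓡 d) x).target) :
    (mfderiv (𝓡 d) (𝓡 d) (extChartAt (𝓡 d) x).symm z).IsInvertible := by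
  have := isInvertible_mfderivWithin_extChartAt_symm (I := 𝓡 d) hz
  rwa [ModelWithCorners.range_eq_univ, mfderivWithin_univ] at this

theorem IsSmoothVectorFieldOn.sum_smul {k : ℕ} {X : Fin k → Π x : M, TangentSpace (𝓡 d) x}
    {U : Set M} (hX : ∀ j, IsSmoothVectorFieldOn (X j) U) (a : Fin k → ℝ) :
    IsSmoothVectorFieldOn (fun x => ∑ j, a j • X j x) U :=
  ContMDiffOn.sum_section fun j _ => (hX j).const_smul_section (a := a j)

theorem mlieBracket_eq_lieBracket {E : Type*} [NormedAddCommGroup E] [NormedSpace ℝ E]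
    (V W : E → E) (z : E) : mlieBracket 𝓘(ℝ, E) V W z = lieBracket ℝ V W z := by
  have h : mlieBracketWithin 𝓘(ℝ, E) V W univ = lieBracketWithin ℝ V W univ :=
    mlieBracketWithin_eq_lieBracketWithin
  exact congrFun (mlieBracketWithin_univ.symm.trans (h.trans lieBracketWithin_univ)) z

/-- The **Frobenius theorem**: an involutive smooth distribution has an integral manifold through
every point. -/
theorem HasIntegralManifolds.of_isInvolutive
    {D : Π x : M, Submodule ℝ (TangentSpace (𝓡 d) x)} (hD : IsSmoothDistribution D)
    (hinv : IsInvolutive D) : HasIntegralManifolds D := by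
  intro x
  obtain ⟨U, k, X, hU, hxU, hX, hXD⟩ := hD x
  set e := extChartAt (𝓡 d) x with he
  have heo : IsOpen e.target := isOpen_extChartAt_target x
  set Ω : Set (EuclideanSpace ℝ (Fin d)) := e.target ∩ e.symm ⁻¹' U with hΩ
  have hΩo : IsOpen Ω := (continuousOn_extChartAt_symm x).isOpen_inter_preimage heo hU
  have hxΩ : e x ∈ Ω := ⟨mem_extChartAt_target x, by
    rw [mem_preimage, he, extChartAt_to_inv]; exact hxU⟩
  have hσ : ∀ z ∈ Ω, ContMDiffAt (𝓡 d) (𝓡 d) ∞ e.symm z :=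
    fun z hz => contMDiffAt_extChartAt_symm hz.1
  have hσ' : ∀ z ∈ Ω, (mfderiv (𝓡 d) (𝓡 d) e.symm z).IsInvertible :=
    fun z hz => isInvertible_mfderiv_extChartAt_symm hz.1
  -- constant coefficient combinations of the frame and their coordinate expressions
  set Z : EuclideanSpace ℝ (Fin k) → Π y : M, TangentSpace (𝓡 d) y :=
    fun a y => ∑ j, a j • X j y with hZ
  have hZs : ∀ a, IsSmoothVectorFieldOn (Z a) U := fun a => .sum_smul hX a
  set Y : EuclideanSpace ℝ (Fin k) → EuclideanSpace ℝ (Fin d) → EuclideanSpace ℝ (Fin d) :=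
    fun a => mpullback (𝓡 d) (𝓡 d) e.symm (Z a) with hY
  have hYs : ∀ a, ∀ z ∈ Ω, ContDiffAt ℝ ∞ (Y a) z := fun a z hz =>
    contMDiffAt_vectorSpace_iff_contDiffAt.1
      (((hZs a).contMDiffAt hU hz.2).mpullback_vectorField_preimage (hσ z hz) (hσ' z hz) le_rfl)
  set F : EuclideanSpace ℝ (Fin d) → EuclideanSpace ℝ (Fin k) →L[ℝ] EuclideanSpace ℝ (Fin d) :=
    fun z => ∑ j, (EuclideanSpace.proj j).smulRight (Y (EuclideanSpace.single j 1) z) with hF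
  have hFY : ∀ z a, F z a = Y a z := fun z a => by
    have h1 : Z a (e.symm z) = ∑ j, a j • Z (EuclideanSpace.single j 1) (e.symm z) := by
      refine Finset.sum_congr rfl fun j _ => ?_
      congr 1
      simp [hZ, ite_smul]
    have h2 : Y a z = ∑ j, a j • Y (EuclideanSpace.single j 1) z := by
      simp only [hY, mpullback_apply]
      rw [h1, map_sum]
      exact Finset.sum_congr rfl fun j _ => map_smul _ _ _
    rw [h2, hF, sum_apply]
    rfl
  have hFs : ContDiffOn ℝ ∞ F Ω := fun z hz => by
    refine (ContDiffAt.sum fun j _ => ?_).contDiffWithinAt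
    exact contDiffAt_const.smulRight (hYs _ z hz)
  have hσF : ∀ z ∈ Ω, ∀ a, mfderiv (𝓡 d) (𝓡 d) e.symm z (F z a) = Z a (e.symm z) := fun z hz a => by
    rw [hFY]
    exact (hσ' z hz).self_apply_inverse _
  have hZrange : ∀ y ∈ U, ∀ v ∈ D y, ∃ a, Z a y = v := fun y hy v hv => by
    rw [← (hXD y hy).2, Submodule.mem_span_range_iff_exists_fun] at hv
    obtain ⟨c, hc⟩ := hv
    exact ⟨WithLp.toLp 2 c, hc⟩
  have hZD : ∀ a, ∀ y ∈ U, Z a y ∈ D y := fun a y hy => by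
    rw [← (hXD y hy).2]
    exact Submodule.sum_mem _ fun j _ => Submodule.smul_mem _ _ (Submodule.subset_span ⟨j, rfl⟩)
  have hZinj : ∀ y ∈ U, ∀ a, Z a y = 0 → a = 0 := fun y hy a ha => by
    ext j
    exact Fintype.linearIndependent_iff.1 (hXD y hy).1 (fun j => a j) ha j
  have hFinj : ∀ z ∈ Ω, Function.Injective (F z) := fun z hz =>
    (injective_iff_map_eq_zero _).2 fun a ha => hZinj _ hz.2 a (by
      rw [← hσF z hz, ha]
      exact (mfderiv (𝓡 d) (𝓡 d) e.symm z).map_zero)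
  have hFinv : ∀ z ∈ Ω, ∀ a b, ∃ c,
      fderiv ℝ F z (F z a) b - fderiv ℝ F z (F z b) a = F z c := fun z hz a b => by
    have hFd : DifferentiableAt ℝ F z :=
      (hFs.contDiffAt (hΩo.mem_nhds hz)).differentiableAt (by simp)
    have hfd : ∀ b v, fderiv ℝ (Y b) z v = fderiv ℝ F z v b := fun b v => by
      have h1 : HasFDerivAt (fun z => F z b) ((fderiv ℝ F z).flip b) z :=
        (hFd.hasFDerivAt.clm_apply (hasFDerivAt_const b z)).congr_fderiv (by ext; simp)
      simp only [hFY] at h1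
      rw [h1.fderiv]
      rfl
    obtain ⟨c, hc⟩ := hZrange _ hz.2 _
      (hinv U (Z a) (Z b) hU (hZs a) (hZs b) (hZD a) (hZD b) _ hz.2)
    refine ⟨c, ?_⟩
    have : IsManifold (𝓡 d) (minSmoothness ℝ 2) M := by
      rw [minSmoothness_of_isRCLikeNormedField]
      exact IsManifold.of_le (n := ∞) ENat.LEInfty.out
    have hb := mpullback_mlieBracket (I := 𝓡 d) (I' := 𝓡 d) (n := ∞)
      (((hZs a).contMDiffAt hU hz.2).mdifferentiableAt (by simp))
      (((hZs b).contMDiffAt hU hz.2).mdifferentiableAt (by simp)) (hσ z hz)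
      (by rw [minSmoothness_of_isRCLikeNormedField]; exact ENat.LEInfty.out)
    rw [mpullback_apply, ← hc] at hb
    rw [hFY z c]
    change Y c z = mlieBracket 𝓘(ℝ, EuclideanSpace ℝ (Fin d)) (Y a) (Y b) z at hb
    rw [hb.trans (mlieBracket_eq_lieBracket (Y a) (Y b) z), lieBracket_eq]
    simp only [hfd, hFY]
  obtain ⟨r, hr, φ, hφ0, hφs, hφi, hφ⟩ :=
    exists_hasFDerivAt_comp_of_involutive hΩo hxΩ hFs (hFinj _ hxΩ) hFinv
  have hmf : ∀ u ∈ Metric.ball (0 : EuclideanSpace ℝ (Fin k)) r,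
      ∃ L : EuclideanSpace ℝ (Fin k) ≃L[ℝ] EuclideanSpace ℝ (Fin k), ∀ v,
        mfderiv (𝓡 k) (𝓡 d) (e.symm ∘ φ) u v = Z (L v) (e.symm (φ u)) := fun u hu => by
    obtain ⟨hu1, L, hL⟩ := hφ u hu
    refine ⟨L, fun v => ?_⟩
    rw [mfderiv_comp u ((hσ _ hu1).mdifferentiableAt (by simp))
      hL.differentiableAt.mdifferentiableAt, mfderiv_eq_fderiv, hL.fderiv]
    exact hσF _ hu1 _
  refine ⟨k, Metric.ball 0 r, e.symm ∘ φ, Metric.isOpen_ball, Metric.mem_ball_self hr, ?_, ?_, ?_,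
    fun u hu => ?_⟩
  · simp [hφ0, he]
  · exact (contMDiffOn_extChartAt_symm x).comp hφs.contMDiffOn fun u hu => (hφ u hu).1.1
  · exact e.symm.injOn.comp hφi fun u hu => (hφ u hu).1.1
  · obtain ⟨L, hL⟩ := hmf u hu
    have huU : e.symm (φ u) ∈ U := (hφ u hu).1.2
    constructor
    · exact (injective_iff_map_eq_zero _).2 fun v hv => by
        rw [hL] at hv
        exact L.map_eq_zero_iff.1 (hZinj _ huU _ hv)
    · ext w
      constructor
      · rintro ⟨v, rfl⟩
        change mfderiv (𝓡 k) (𝓡 d) (e.symm ∘ φ) u v ∈ _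
        rw [hL]
        exact hZD _ _ huU
      · intro hw
        obtain ⟨a, rfl⟩ := hZrange _ huU w hw
        exact ⟨L.symm a, (hL _).trans (by simp)⟩

end Integral

/-! ### Smoothness of the tangential part of `J` -/

section Smooth

variable {d : ℕ} {M : Type*} [TopologicalSpace M] [ChartedSpace (EuclideanSpace ℝ (Fin d)) M]
  [IsManifold (𝓡 d) ∞ M] [RiemannianBundle (fun x : M => TangentSpace (𝓡 d) x)]
  [IsContMDiffRiemannianBundle (𝓡 d) ∞ (EuclideanSpace ℝ (Fin d))
    (fun x : M => TangentSpace (𝓡 d) x)]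

/-- A vector field on a Riemannian manifold is smooth at a point as soon as its inner products with
all smooth vector fields are. -/
theorem contMDiffAt_of_inner {Z : Π x : M, TangentSpace (𝓡 d) x} {x : M}
    (h : ∀ W : Π x : M, TangentSpace (𝓡 d) x,
      ContMDiffAt (𝓡 d) ((𝓡 d).prod 𝓘(ℝ, EuclideanSpace ℝ (Fin d))) ∞ (T% W) x →
      ContMDiffAt (𝓡 d) 𝓘(ℝ, ℝ) ∞ (fun y => inner ℝ (Z y) (W y)) x) :
    ContMDiffAt (𝓡 d) ((𝓡 d).prod 𝓘(ℝ, EuclideanSpace ℝ (Fin d))) ∞ (T% Z) x := by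
  set e := trivializationAt (EuclideanSpace ℝ (Fin d)) (TangentSpace (𝓡 d) : M → Type _) x with he
  have hx : x ∈ e.baseSet := FiberBundle.mem_baseSet_trivializationAt' x
  have hnhds : e.baseSet ∈ 𝓝 x := e.open_baseSet.mem_nhds hx
  set s := e.localFrame (EuclideanSpace.basisFun (Fin d) ℝ).toBasis with hsdef
  have hs : IsLocalFrameOn (𝓡 d) (EuclideanSpace ℝ (Fin d)) ∞ s e.baseSet :=
    e.isLocalFrameOn_localFrame_baseSet (𝓡 d) ∞ _
  have hsx : ∀ i, ContMDiffAt (𝓡 d) ((𝓡 d).prod 𝓘(ℝ, EuclideanSpace ℝ (Fin d))) ∞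
      (T% (s i)) x := fun i => hs.contMDiffAt e.open_baseSet hx i
  -- the Gram matrix of the frame, as an operator on coefficient vectors
  set Φ : M → (Fin d → ℝ) →L[ℝ] (Fin d → ℝ) := fun y => ∑ i, ∑ j,
    (inner ℝ (s j y) (s i y) : ℝ) •
      (ContinuousLinearMap.proj (R := ℝ) (φ := fun _ : Fin d => ℝ) j).smulRight
        (Pi.single i 1 : Fin d → ℝ) with hΦ
  have hΦs : ContMDiffAt (𝓡 d) 𝓘(ℝ, (Fin d → ℝ) →L[ℝ] (Fin d → ℝ)) ∞ Φ x :=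
    contMDiffAt_finsetSum fun i _ => contMDiffAt_finsetSum fun j _ =>
      ((hsx j).inner_bundle (hsx i)).smul contMDiffAt_const
  have hΦapply : ∀ y u i, Φ y u i = inner ℝ (∑ j, u j • s j y) (s i y) := fun y u i => by
    simp [hΦ, sum_apply, sum_inner, inner_smul_left, Pi.single_apply, mul_comm]
  have hunit : IsUnit (Φ x) := by
    have hinj : Function.Injective (Φ x) := (injective_iff_map_eq_zero _).2 fun u hu => by
      have h0 : ∑ j, u j • s j x = 0 := by
        rw [← inner_self_eq_zero (𝕜 := ℝ)]
        rw [inner_sum]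
        refine Finset.sum_eq_zero fun i _ => ?_
        rw [inner_smul_right, ← hΦapply, hu]
        simp
      funext j
      exact Fintype.linearIndependent_iff.1 (hs.linearIndependent hx) u h0 j
    exact ContinuousLinearMap.isUnit_iff_bijective.2
      ⟨hinj, (LinearMap.injective_iff_surjective (f := (Φ x).toLinearMap)).1 hinj⟩
  set c : M → Fin d → ℝ := fun y i => hs.coeff i y (Z y) with hc
  have hcw : ∀ᶠ y in 𝓝 x, c y = Ring.inverse (Φ y) (fun i => inner ℝ (Z y) (s i y)) := by
    filter_upwards [hnhds, hΦs.continuousAt.preimage_mem_nhds (Units.isOpen.mem_nhds hunit)]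
      with y hy hyu
    have h1 : Φ y (c y) = fun i => inner ℝ (Z y) (s i y) := by
      funext i
      rw [hΦapply, ← hs.coeff_sum_eq Z hy]
    rw [← h1]
    exact congr($((Ring.inverse_mul_cancel (Φ y) hyu).symm) (c y))
  have hinv : ContMDiffAt (𝓡 d) 𝓘(ℝ, (Fin d → ℝ) →L[ℝ] (Fin d → ℝ)) ∞
      (fun y => Ring.inverse (Φ y)) x := by
    obtain ⟨u, hu⟩ := hunit
    have : ContDiffAt ℝ ∞ Ring.inverse (Φ x) := hu ▸ contDiffAt_ringInverse ℝ u
    exact this.comp_contMDiffAt hΦs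
  have hcs : ContMDiffAt (𝓡 d) 𝓘(ℝ, Fin d → ℝ) ∞ c x :=
    (hinv.clm_apply (contMDiffAt_pi_space.2 fun i => h _ (hsx i))).congr_of_eventuallyEq hcw
  exact hs.contMDiffAt_of_coeff (fun i => contMDiffAt_pi_space.1 hcs i) hnhds

end Smooth

section Operator
variable {n m : ℕ}
  {N : Type*} [TopologicalSpace N] [ChartedSpace (EuclideanSpace ℝ (Fin m)) N]
  [RiemannianBundle (fun y : N => TangentSpace (𝓡 m) y)]
  {M : Type*} [TopologicalSpace M] [ChartedSpace (EuclideanSpace ℝ (Fin n)) M]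
  [RiemannianBundle (fun x : M => TangentSpace (𝓡 n) x)]
  {i : M → N}

theorem IsIsometricImmersion.inner_tangentialPart (hi : IsIsometricImmersion n m i) (x : M)
    (w : TangentSpace (𝓡 m) (i x)) (v : TangentSpace (𝓡 n) x) :
    inner ℝ (hi.tangentialPart x w) v = inner ℝ w (mfderiv (𝓡 n) (𝓡 m) i x v) := by
  have h1 : hi.differential x (hi.tangentialPart x w) =
      (LinearMap.range (hi.differential x).toLinearMap).starProjection w := by
    have := (hi.differential x).equivRange.apply_symm_apply
      ((LinearMap.range (hi.differential x).toLinearMap).orthogonalProjectionOnto w)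
    exact congrArg Subtype.val this
  rw [← (hi.differential x).inner_map_map, h1]
  refine (Submodule.inner_starProjection_left_eq_right _ _ _).trans ?_
  have h2 : (LinearMap.range (hi.differential x).toLinearMap).starProjection
      (hi.differential x v) = hi.differential x v :=
    Submodule.starProjection_eq_self_iff.2 ⟨v, rfl⟩
  rw [h2]
  rfl

theorem IsIsometricImmersion.inner_tangentialOperator (hi : IsIsometricImmersion n m i)
    (J : Π y : N, TangentSpace (𝓡 m) y →L[ℝ] TangentSpace (𝓡 m) y) (x : M)
    (u v : TangentSpace (𝓡 n) x) :
    inner ℝ (hi.tangentialOperator J x u) v =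
      inner ℝ (J (i x) (mfderiv (𝓡 n) (𝓡 m) i x u)) (mfderiv (𝓡 n) (𝓡 m) i x v) :=
  hi.inner_tangentialPart x _ v

variable [IsManifold (𝓡 m) ∞ N] [IsManifold (𝓡 n) ∞ M]
  [IsContMDiffRiemannianBundle (𝓡 m) ∞ (EuclideanSpace ℝ (Fin m))
      (fun y : N => TangentSpace (𝓡 m) y)]
  [IsContMDiffRiemannianBundle (𝓡 n) ∞ (EuclideanSpace ℝ (Fin n))
      (fun x : M => TangentSpace (𝓡 n) x)]

theorem IsIsometricImmersion.isSmoothVectorFieldOn_tangentialOperator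
    (hi : IsIsometricImmersion n m i) {p q : ℕ}
    {J : Π y : N, TangentSpace (𝓡 m) y →L[ℝ] TangentSpace (𝓡 m) y}
    (hJ : IsMetallicRiemannian p q J) {Y : Π x : M, TangentSpace (𝓡 n) x} {U : Set M}
    (hU : IsOpen U) (hY : IsSmoothVectorFieldOn Y U) :
    IsSmoothVectorFieldOn (fun x => hi.tangentialOperator J x (Y x)) U := by
  have hpush : ∀ (W : Π x : M, TangentSpace (𝓡 n) x) (x : M),
      ContMDiffAt (𝓡 n) ((𝓡 n).prod 𝓘(ℝ, EuclideanSpace ℝ (Fin n))) ∞ (T% W) x →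
      ContMDiffAt (𝓡 n) ((𝓡 m).prod 𝓘(ℝ, EuclideanSpace ℝ (Fin m))) ∞
        (fun y => (⟨i y, mfderiv (𝓡 n) (𝓡 m) i y (W y)⟩ :
          TotalSpace (EuclideanSpace ℝ (Fin m)) (TangentSpace (𝓡 m) : N → Type _))) x :=
    fun W x hW => ((hi.smooth.contMDiff_tangentMap (m := ∞) le_rfl).contMDiffAt).comp x hW
  intro x hx
  refine ContMDiffAt.contMDiffWithinAt (contMDiffAt_of_inner fun W hW => ?_)
  simp only [hi.inner_tangentialOperator]
  have hJi := (hJ.smooth.comp hi.smooth).contMDiffAt (x := x)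
  exact (hJi.clm_bundle_apply (hpush Y x (hY.contMDiffAt hU hx))).inner_bundle (hpush W x hW)

end Operator

/-! ### Compressions of metallic operators to subspaces -/

section LinearAlgebra

theorem eq_zero_of_sq_eq {V : Type*} [AddCommGroup V] [Module ℝ V] {t : V →ₗ[ℝ] V} {p q l : ℝ}
    (hq : q ≠ 0) (hl : l ≠ 1) {v : V} (h : t (t v) = p • t v + q • v)
    (h' : t (t v) = l • (p • t v + q • v)) : v = 0 := by
  rw [h] at h'
  have h0 : p • t v + q • v = 0 := by
    have : (1 - l) • (p • t v + q • v) = 0 := by rw [sub_smul, one_smul, ← h', sub_self]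
    exact (smul_eq_zero.1 this).resolve_left (sub_ne_zero.2 hl.symm)
  rw [h0] at h
  have h1 : q • t v = 0 := by simpa [h] using congrArg t h0
  have h2 : t v = 0 := (smul_eq_zero.1 h1).resolve_left hq
  rw [h2, smul_zero, zero_add] at h0
  exact (smul_eq_zero.1 h0).resolve_left hq

section Kernel
variable {V : Type*} [AddCommGroup V] [Module ℝ V] {t : V →ₗ[ℝ] V} {S₁ S₂ : Submodule ℝ V}
  {p q l : ℝ}

/-- Two complementary subspaces on which `t` satisfies two different quadratic equations are the
solution sets of these equations: the two equations have no common nonzero solution. -/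
theorem mem_iff_sq_eq_of_isCompl (hS : IsCompl S₁ S₂) (hq : q ≠ 0) (hl : l ≠ 1)
    (h₁ : ∀ v ∈ S₁, t (t v) = p • t v + q • v)
    (h₂ : ∀ v ∈ S₂, t (t v) = l • (p • t v + q • v)) (v : V) :
    (v ∈ S₁ ↔ t (t v) = p • t v + q • v) ∧ (v ∈ S₂ ↔ t (t v) = l • (p • t v + q • v)) := by
  obtain ⟨a, ha, b, hb, rfl⟩ : ∃ a ∈ S₁, ∃ b ∈ S₂, a + b = v :=
    Submodule.mem_sup.1 (hS.sup_eq_top ▸ Submodule.mem_top)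
  have ha' := h₁ a ha
  have hb' := h₂ b hb
  refine ⟨⟨h₁ _, fun h => ?_⟩, ⟨h₂ _, fun h => ?_⟩⟩
  · have : b = 0 := by
      refine eq_zero_of_sq_eq hq hl ?_ hb'
      rw [map_add, map_add, ha'] at h
      have h3 : t (t b) = (p • (t a + t b) + q • (a + b)) - (p • t a + q • a) :=
        eq_sub_of_add_eq' h
      rw [h3]; module
    simpa [this] using ha
  · have : a = 0 := by
      refine eq_zero_of_sq_eq hq hl ha' ?_
      rw [map_add, map_add, hb'] at h
      have h3 : t (t a) = l • (p • (t a + t b) + q • (a + b)) - l • (p • t b + q • b) :=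
        eq_sub_of_add_eq h
      rw [h3]; module
    simpa [this] using hb

end Kernel

/-! `f` is an isometric embedding, `j` an operator of the ambient space and `t` its compression. -/

section Metallic
variable {V W : Type*} [NormedAddCommGroup V] [InnerProductSpace ℝ V]
  [NormedAddCommGroup W] [InnerProductSpace ℝ W] {f : V →ₗᵢ[ℝ] W} {j : W →ₗ[ℝ] W} {t : V →ₗ[ℝ] V}
  {S₁ S₂ : Submodule ℝ V} {p q : ℝ}

/-- On a subspace mapped to itself by `j`, the compression `t` of `j` to `V` is `j`. -/
theorem compression_mem_of_invariant (ht : ∀ u v, inner ℝ (t u) v = inner ℝ (j (f u)) (f v))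
    (hS : (S₁.map f.toLinearMap).map j = S₁.map f.toLinearMap) {v : V} (hv : v ∈ S₁) :
    t v ∈ S₁ ∧ j (f v) = f (t v) := by
  have : j (f v) ∈ S₁.map f.toLinearMap := hS ▸ ⟨f v, ⟨v, hv, rfl⟩, rfl⟩
  obtain ⟨w, hw, hwv⟩ := this
  have htw : t v = w := ext_inner_right ℝ fun u => by
    rw [ht, ← hwv]
    exact f.inner_map_map w u
  rw [htw]
  exact ⟨hw, hwv.symm⟩

theorem compression_sq_of_invariant (ht : ∀ u v, inner ℝ (t u) v = inner ℝ (j (f u)) (f v))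
    (hj : ∀ w, j (j w) = p • j w + q • w)
    (hS : (S₁.map f.toLinearMap).map j = S₁.map f.toLinearMap) {v : V} (hv : v ∈ S₁) :
    t (t v) = p • t v + q • v := by
  obtain ⟨h1, h2⟩ := compression_mem_of_invariant ht hS hv
  obtain ⟨-, h3⟩ := compression_mem_of_invariant ht hS h1
  apply f.injective
  rw [← h3, ← h2, hj, h2, map_add, map_smul, map_smul]

theorem compression_symmetric (ht : ∀ u v, inner ℝ (t u) v = inner ℝ (j (f u)) (f v))
    (hsymm : ∀ v w, inner ℝ (j v) w = inner ℝ v (j w)) (u v : V) :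
    inner ℝ (t u) v = inner ℝ u (t v) := by
  rw [ht, hsymm, real_inner_comm, ← ht, real_inner_comm]

theorem compression_mem_of_orthogonal (ht : ∀ u v, inner ℝ (t u) v = inner ℝ (j (f u)) (f v))
    (hsymm : ∀ v w, inner ℝ (j v) w = inner ℝ v (j w))
    (hS : (S₁.map f.toLinearMap).map j = S₁.map f.toLinearMap)
    (horth : ∀ u ∈ S₁, ∀ v ∈ S₂, inner ℝ u v = 0) (hcompl : IsCompl S₁ S₂) {v : V}
    (hv : v ∈ S₂) : t v ∈ S₂ := by
  obtain ⟨a, ha, b, hb, hab⟩ : ∃ a ∈ S₁, ∃ b ∈ S₂, a + b = t v :=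
    Submodule.mem_sup.1 (hcompl.sup_eq_top ▸ Submodule.mem_top)
  have h0 : inner ℝ (t v) a = 0 := by
    rw [compression_symmetric ht hsymm, real_inner_comm]
    exact horth _ (compression_mem_of_invariant ht hS ha).1 _ hv
  rw [← hab, inner_add_left, real_inner_comm a b, horth a ha b hb, add_zero,
    inner_self_eq_zero] at h0
  rw [← hab, h0, zero_add]
  exact hb

theorem starProjection_eq_compression (ht : ∀ u v, inner ℝ (t u) v = inner ℝ (j (f u)) (f v))
    {S : Submodule ℝ V} [(S.map f.toLinearMap).HasOrthogonalProjection] {v : V} (htv : t v ∈ S) :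
    (S.map f.toLinearMap).starProjection (j (f v)) = f (t v) := by
  refine Submodule.eq_starProjection_of_mem_of_inner_eq_zero ⟨t v, htv, rfl⟩ ?_
  rintro _ ⟨u, -, rfl⟩
  change inner ℝ (j (f v) - f (t v)) (f u) = 0
  rw [inner_sub_left, f.inner_map_map, ht, sub_self]

/-- The slant condition in terms of norms: by `ht`, the inner product of `j (f v)` and `f (t v)` is
`‖t v‖ ^ 2`. -/
theorem norm_compression_eq_cos_mul
    (ht : ∀ u v, inner ℝ (t u) v = inner ℝ (j (f u)) (f v)) {θ : ℝ} {v : V}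
    (hθ : InnerProductGeometry.angle (j (f v)) (f (t v)) = θ) :
    ‖t v‖ = Real.cos θ * ‖j (f v)‖ := by
  have h := InnerProductGeometry.cos_angle_mul_norm_mul_norm (j (f v)) (f (t v))
  rw [hθ, ← ht, real_inner_self_eq_norm_sq, f.norm_map] at h
  rcases eq_or_ne (t v) 0 with h0 | h0
  · rw [h0, map_zero, InnerProductGeometry.angle_zero_right] at hθ
    rw [h0, ← hθ, Real.cos_pi_div_two, norm_zero, zero_mul]
  · have := norm_ne_zero_iff.2 h0
    apply mul_right_cancel₀ this
    linarith

theorem compression_sq_of_slant (ht : ∀ u v, inner ℝ (t u) v = inner ℝ (j (f u)) (f v))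
    (hsymm : ∀ v w, inner ℝ (j v) w = inner ℝ v (j w)) (hj : ∀ w, j (j w) = p • j w + q • w)
    {S : Submodule ℝ V} (hS : ∀ v ∈ S, t v ∈ S) {l : ℝ}
    (hl : ∀ v ∈ S, ‖t v‖ ^ 2 = l * ‖j (f v)‖ ^ 2) {v : V} (hv : v ∈ S) :
    t (t v) = l • (p • t v + q • v) := by
  have hquad : ∀ v ∈ S, inner ℝ (t (t v)) v = inner ℝ (l • (p • t v + q • v)) v := by
    intro v hv
    rw [compression_symmetric ht hsymm, real_inner_self_eq_norm_sq, hl v hv,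
      ← real_inner_self_eq_norm_sq, ← hsymm, hj, inner_add_left, inner_smul_left, inner_smul_left,
      ← ht, f.inner_map_map, inner_smul_left, inner_add_left, inner_smul_left, inner_smul_left]
    rfl
  -- polarize the quadratic identity
  have hpol : ∀ u ∈ S, inner ℝ (t (t v)) u = inner ℝ (l • (p • t v + q • v)) u := by
    intro u hu
    have h1 := hquad v hv
    have h2 := hquad u hu
    have h3 := hquad (v + u) (S.add_mem hv hu)
    have h4 : inner ℝ (t (t u)) v = inner ℝ (t (t v)) u := by
      rw [compression_symmetric ht hsymm, compression_symmetric ht hsymm, real_inner_comm]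
    have h5 : inner ℝ (t u) v = inner ℝ (t v) u := by
      rw [compression_symmetric ht hsymm, real_inner_comm]
    simp only [map_add, smul_add, inner_add_left, inner_add_right, inner_smul_left, h4, h5,
      real_inner_comm v u, conj_trivial] at h1 h2 h3 ⊢
    linarith
  have hmem : t (t v) - l • (p • t v + q • v) ∈ S :=
    S.sub_mem (hS _ (hS _ hv)) (S.smul_mem _ (S.add_mem (S.smul_mem _ (hS _ hv)) (S.smul_mem _ hv)))
  rw [← sub_eq_zero, ← inner_self_eq_zero (𝕜 := ℝ), inner_sub_left, hpol _ hmem, sub_self]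

end Metallic
end LinearAlgebra

/-! ### Kernels of polynomials in a parallel tensor field -/

section Parallel
variable {d : ℕ} {M : Type*} [TopologicalSpace M] [ChartedSpace (EuclideanSpace ℝ (Fin d)) M]
  [IsManifold (𝓡 d) ∞ M]

/-- The kernel of a quadratic polynomial in a parallel tensor field is preserved by the connection,
hence involutive if there is no torsion. -/
theorem isInvolutive_of_isParallel
    {cov : CovariantDerivative (𝓡 d) (EuclideanSpace ℝ (Fin d))
      (TangentSpace (𝓡 d) : M → Type _)} (hcov : cov.torsion = 0)
    {A : Π x : M, TangentSpace (𝓡 d) x →L[ℝ] TangentSpace (𝓡 d) x} (hA : IsParallel cov A)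
    (hAs : ∀ (U : Set M) (Y : Π x : M, TangentSpace (𝓡 d) x), IsOpen U →
      IsSmoothVectorFieldOn Y U → IsSmoothVectorFieldOn (fun x => A x (Y x)) U)
    {D : Π x : M, Submodule ℝ (TangentSpace (𝓡 d) x)} {α β : ℝ}
    (hD : ∀ x v, v ∈ D x ↔ A x (A x v) = α • A x v + β • v) : IsInvolutive D := by
  have key : ∀ (U : Set M) (Y : Π x : M, TangentSpace (𝓡 d) x), IsOpen U →
      IsSmoothVectorFieldOn Y U → (∀ x ∈ U, Y x ∈ D x) → ∀ x ∈ U, ∀ v, cov Y x v ∈ D x := by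
    intro U Y hU hY hYD x hx v
    have hAY := hAs U Y hU hY
    have hYd := (hY.contMDiffAt hU hx).mdifferentiableAt (by simp)
    have hAYd := (hAY.contMDiffAt hU hx).mdifferentiableAt (by simp)
    have hα : MDifferentiableAt (𝓡 d) ((𝓡 d).prod 𝓘(ℝ, EuclideanSpace ℝ (Fin d)))
        (T% (α • fun y => A y (Y y))) x :=
      ((hAY.contMDiffAt hU hx).const_smul_section (a := α)).mdifferentiableAt (by simp)
    have hβ : MDifferentiableAt (𝓡 d) ((𝓡 d).prod 𝓘(ℝ, EuclideanSpace ℝ (Fin d)))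
        (T% (β • Y)) x :=
      ((hY.contMDiffAt hU hx).const_smul_section (a := β)).mdifferentiableAt (by simp)
    have h1 : ∀ v, cov (fun y => A y (Y y)) x v = A x (cov Y x v) :=
      fun v => sub_eq_zero.1 (hA U Y hU hY x hx v)
    have h2 : cov (fun y => A y (A y (Y y))) x v = A x (cov (fun y => A y (Y y)) x v) :=
      sub_eq_zero.1 (hA U _ hU hAY x hx v)
    have h3 : cov (fun y => A y (A y (Y y))) x =
        cov ((α • fun y => A y (Y y)) + β • Y) x := by
      refine cov.isCovariantDerivativeOn.congr_of_eventuallyEq (s := univ)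
        (((hAs U _ hU hAY).contMDiffAt hU hx).mdifferentiableAt (by simp))
        (((hAY.contMDiffAt hU hx).const_smul_section (a := α)).add_section
          ((hY.contMDiffAt hU hx).const_smul_section (a := β)) |>.mdifferentiableAt (by simp))
        Filter.univ_mem ?_
      filter_upwards [hU.mem_nhds hx] with y hy using (hD y _).1 (hYD y hy)
    rw [h3, cov.isCovariantDerivativeOn.add hα hβ, cov.isCovariantDerivativeOn.smul_const α hAYd,
      cov.isCovariantDerivativeOn.smul_const β hYd] at h2
    rw [hD, ← h1, ← h2]
    rfl
  intro U X Y hU hX hY hXD hYD x hx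
  have ht := (cov.torsion_eq_zero_iff.1 hcov) ((hX.contMDiffAt hU hx).mdifferentiableAt (by simp))
    ((hY.contMDiffAt hU hx).mdifferentiableAt (by simp))
  rw [← ht]
  exact (D x).sub_mem (key U Y hU hY hYD x hx _) (key U X hU hX hXD x hx _)

end Parallel

/-! ### The distributions of a semi-slant submanifold -/

section Semislant
variable {n m : ℕ}
  {N : Type*} [TopologicalSpace N] [ChartedSpace (EuclideanSpace ℝ (Fin m)) N]
  [IsManifold (𝓡 m) ∞ N]
  [RiemannianBundle (fun y : N => TangentSpace (𝓡 m) y)]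
  {M : Type*} [TopologicalSpace M] [ChartedSpace (EuclideanSpace ℝ (Fin n)) M]
  [IsManifold (𝓡 n) ∞ M] [RiemannianBundle (fun x : M => TangentSpace (𝓡 n) x)]
  {i : M → N}

/-- On a semi-slant submanifold, both distributions are kernels of quadratic polynomials with constant
coefficients in the tangential operator. Here `l` is `cos² θ`, except that any `l ≠ 1` serves if
`D₂ = 0`, when the slant condition says nothing about `θ`. -/
theorem IsSemiSlant.exists_mem_iff {p q : ℕ}
    {J : Π y : N, TangentSpace (𝓡 m) y →L[ℝ] TangentSpace (𝓡 m) y}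
    (hJ : IsMetallicRiemannian p q J) (hi : IsIsometricImmersion n m i)
    {D₁ D₂ : Π x : M, Submodule ℝ (TangentSpace (𝓡 n) x)} (hD : IsSemiSlant i J D₁ D₂) :
    ∃ l : ℝ, ∀ (x : M) (v : TangentSpace (𝓡 n) x),
      (v ∈ D₁ x ↔ hi.tangentialOperator J x (hi.tangentialOperator J x v) =
        (p : ℝ) • hi.tangentialOperator J x v + (q : ℝ) • v) ∧
      (v ∈ D₂ x ↔ hi.tangentialOperator J x (hi.tangentialOperator J x v) =
        l • ((p : ℝ) • hi.tangentialOperator J x v + (q : ℝ) • v)) := by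
  obtain ⟨θ, hθ0, hθ⟩ := hD.slant
  have hq : (q : ℝ) ≠ 0 := Nat.cast_ne_zero.2 hJ.q_pos.ne'
  have ht : ∀ (x : M) (u v : TangentSpace (𝓡 n) x),
      inner ℝ ((hi.tangentialOperator J x).toLinearMap u) v =
        inner ℝ ((J (i x)).toLinearMap (hi.differential x u)) (hi.differential x v) :=
    hi.inner_tangentialOperator J
  have hmem₂ : ∀ x, ∀ v ∈ D₂ x, (hi.tangentialOperator J x).toLinearMap v ∈ D₂ x :=
    fun x v hv => compression_mem_of_orthogonal (ht x) (hJ.compatible (i x)) (hD.invariant x)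
      (hD.orthogonal x) (hD.isCompl x) hv
  have hangle : ∀ x, ∀ v ∈ D₂ x, v ≠ 0 →
      InnerProductGeometry.angle ((J (i x)).toLinearMap (hi.differential x v))
        (hi.differential x ((hi.tangentialOperator J x).toLinearMap v)) = θ := fun x v hv hv0 => by
    rw [← starProjection_eq_compression (ht x) (hmem₂ x v hv)]
    exact hθ x v hv hv0
  have hnorm : ∀ x, ∀ v ∈ D₂ x, v ≠ 0 → ‖(hi.tangentialOperator J x).toLinearMap v‖ =
      Real.cos θ * ‖(J (i x)).toLinearMap (hi.differential x v)‖ :=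
    fun x v hv hv0 => norm_compression_eq_cos_mul (ht x) (hangle x v hv hv0)
  obtain ⟨l, hl1, hl⟩ : ∃ l : ℝ, l ≠ 1 ∧ ∀ x, ∀ v ∈ D₂ x,
      ‖(hi.tangentialOperator J x).toLinearMap v‖ ^ 2 =
        l * ‖(J (i x)).toLinearMap (hi.differential x v)‖ ^ 2 := by
    by_cases hex : ∃ x, ∃ v ∈ D₂ x, v ≠ 0
    · refine ⟨Real.cos θ ^ 2, fun hcos => ?_, fun x v hv => ?_⟩
      · obtain ⟨x, v, hv, hv0⟩ := hex
        have hθv := hangle x v hv hv0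
        have h0 : 0 ≤ θ := hθv ▸ InnerProductGeometry.angle_nonneg _ _
        have hθπ : θ ≤ Real.pi := hθv ▸ InnerProductGeometry.angle_le_pi _ _
        rcases sq_eq_one_iff.1 hcos with h | h
        · exact hθ0 (Real.injOn_cos ⟨h0, hθπ⟩ ⟨le_rfl, Real.pi_pos.le⟩ (by rw [h, Real.cos_zero]))
        · -- `cos θ = -1` would force `J v = 0`, but then the angle is `π / 2`
          have hn := hnorm x v hv hv0
          rw [h] at hn
          have hJv : ‖(J (i x)).toLinearMap (hi.differential x v)‖ = 0 := by
            linarith [norm_nonneg ((J (i x)).toLinearMap (hi.differential x v)),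
              norm_nonneg ((hi.tangentialOperator J x).toLinearMap v)]
          rw [norm_eq_zero.1 hJv, InnerProductGeometry.angle_zero_left] at hθv
          rw [← hθv, Real.cos_pi_div_two] at h
          norm_num at h
      · rcases eq_or_ne v 0 with rfl | hv0
        · simp
        · rw [hnorm x v hv hv0, mul_pow]
    · push Not at hex
      exact ⟨0, zero_ne_one, fun x v hv => by simp [hex x v hv]⟩
  refine ⟨l, fun x v => mem_iff_sq_eq_of_isCompl (hD.isCompl x) hq hl1
    (fun v hv => compression_sq_of_invariant (ht x) (hJ.sq (i x)) (hD.invariant x) hv)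
    (fun v hv => compression_sq_of_slant (ht x) (hJ.compatible (i x)) (hJ.sq (i x)) (hmem₂ x)
      (hl x) hv) v⟩

end Semislant

end MetallicGeometry

theorem mainTheorem6 {m n : ℕ}
    -- the ambient Riemannian manifold
    {N : Type*} [TopologicalSpace N] [ChartedSpace (EuclideanSpace ℝ (Fin m)) N]
    [IsManifold (𝓡 m) ∞ N] [RiemannianBundle (fun y : N => TangentSpace (𝓡 m) y)]
    [IsContMDiffRiemannianBundle (𝓡 m) ∞ (EuclideanSpace ℝ (Fin m))
      (fun y : N => TangentSpace (𝓡 m) y)]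
    -- the submanifold with its induced metric
    {M : Type*} [TopologicalSpace M] [ChartedSpace (EuclideanSpace ℝ (Fin n)) M]
    [IsManifold (𝓡 n) ∞ M] [RiemannianBundle (fun x : M => TangentSpace (𝓡 n) x)]
    [IsContMDiffRiemannianBundle (𝓡 n) ∞ (EuclideanSpace ℝ (Fin n))
      (fun x : M => TangentSpace (𝓡 n) x)]
    -- the ambient manifold is locally metallic
    (p q : ℕ) (J : Π y : N, TangentSpace (𝓡 m) y →L[ℝ] TangentSpace (𝓡 m) y)
    (covN : CovariantDerivative (𝓡 m) (EuclideanSpace ℝ (Fin m))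
      (TangentSpace (𝓡 m) : N → Type _))
    (hN : MetallicGeometry.IsLocallyMetallicRiemannian p q J covN)
    -- `M` is a semi-slant submanifold
    (i : M → N) (hi : MetallicGeometry.IsIsometricImmersion n m i)
    (D₁ D₂ : Π x : M, Submodule ℝ (TangentSpace (𝓡 n) x))
    (hD : MetallicGeometry.IsSemiSlant i J D₁ D₂)
    -- `T` is parallel for the Levi-Civita connection of `M`
    (covM : CovariantDerivative (𝓡 n) (EuclideanSpace ℝ (Fin n))
      (TangentSpace (𝓡 n) : M → Type _))
    (hM : MetallicGeometry.IsLeviCivita covM)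
    (hT : MetallicGeometry.IsParallel covM (hi.tangentialOperator J)) :
    MetallicGeometry.IsIntegrable D₁ ∧ MetallicGeometry.IsIntegrable D₂ := by
  have hTs : ∀ (U : Set M) (Y : Π x : M, TangentSpace (𝓡 n) x), IsOpen U →
      MetallicGeometry.IsSmoothVectorFieldOn Y U →
      MetallicGeometry.IsSmoothVectorFieldOn (fun x => hi.tangentialOperator J x (Y x)) U :=
    fun U Y hU hY => hi.isSmoothVectorFieldOn_tangentialOperator hN.metallic hU hY
  obtain ⟨l, hl⟩ := hD.exists_mem_iff hN.metallic hi
  have h₁ : MetallicGeometry.IsInvolutive D₁ :=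
    MetallicGeometry.isInvolutive_of_isParallel hM.torsion_eq_zero hT hTs fun x v => (hl x v).1
  have h₂ : MetallicGeometry.IsInvolutive D₂ :=
    MetallicGeometry.isInvolutive_of_isParallel hM.torsion_eq_zero hT hTs (α := l * p)
      (β := l * q) fun x v => by
      rw [(hl x v).2, smul_add, smul_smul, smul_smul]
  exact ⟨⟨h₁, .of_isInvolutive hD.smooth₁ h₁⟩, ⟨h₂, .of_isInvolutive hD.smooth₂ h₂⟩⟩
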